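/- Let $\pi = a+bi \in \mathbb{Z}[i]$ ($a,b\in\mathbb{Z}$) be a Gaussian prime whose norm $p = a^2+b^2$ is a rational prime with $p \equiv 1 \pmod 8$, and assume that $4 \mid b$ and $a \equiv 1 \pmod 4$. Then $$\left[\frac{\pi}{\bar\pi}\right]_4 = \left(\frac{-4}{p}\right)_8 .$$ Here $\bar\pi = a-bi$. For a Gaussian prime $\lambda$ of odd norm $N\lambda$ and $\alpha\in\mathbb{Z}[i]$ with $\lambda\nmid\alpha$, the quartic residue symbol $[\alpha/\lambda]_4$ is the unique $u\in\{1,i,-1,-i\}$ with $\alpha^{(N\lambda-1)/4}\equiv u \pmod{\lambda}$. For an integer $m$ that is prime to $p$ and a fourth power modulo $p$, the rational octic residue symbol $(m/p)_8\in\{1,-1\}$ is determined by $m^{(p-1)/8}\equiv (m/p)_8 \pmod p$, i.e. it is $+1$ if $m$ is an eighth power modulo $p$ and $-1$ otherwise; it is defined for $m=-4$, since $-4\equiv(1+t)^4 \pmod p$ for any integer $t$ with $t^2\equiv-1\pmod p$. -/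

import Mathlib

open Classical in
/-- The quartic residue symbol `[α / ℓ]₄` in the Gaussian integers.  For a Gaussian prime `ℓ` of odd
norm `N ℓ` not dividing `α`, it is the unique fourth root of unity `u ∈ {1, i, -1, -i}` with
`α ^ ((N ℓ - 1) / 4) ≡ u (mod ℓ)`; it is `0` if the odd prime `ℓ` divides `α`.
(The four units are pairwise incongruent modulo such an `ℓ`, so the order of the cases is
irrelevant.) -/
noncomputable def quarticSymbol (α ℓ : GaussianInt) : GaussianInt :=
  if ℓ ∣ α ^ (((Zsqrtd.norm ℓ).natAbs - 1) / 4) - 1 then 1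
  else if ℓ ∣ α ^ (((Zsqrtd.norm ℓ).natAbs - 1) / 4) - ⟨0, 1⟩ then ⟨0, 1⟩
  else if ℓ ∣ α ^ (((Zsqrtd.norm ℓ).natAbs - 1) / 4) + 1 then -1
  else if ℓ ∣ α ^ (((Zsqrtd.norm ℓ).natAbs - 1) / 4) + ⟨0, 1⟩ then ⟨0, -1⟩
  else 0

/-- The rational octic residue symbol `(m / p)₈`, for a prime `p ≡ 1 (mod 8)` and an integer `m`
prime to `p` that is a fourth power modulo `p`: the sign `± 1` with
`m ^ ((p - 1) / 8) ≡ ± 1 (mod p)`.  It is `+1` exactly when `m` is an eighth power modulo `p`.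
Where the symbol is undefined (`m` is not a nonzero fourth power modulo `p`) the value is `0`. -/
def octicSymbol (m : ℤ) (p : ℕ) : ℤ :=
  if m ^ ((p - 1) / 8) ≡ 1 [ZMOD p] then 1
  else if m ^ ((p - 1) / 8) ≡ -1 [ZMOD p] then -1
  else 0

/-!
Put `π = a + b i` and `m = (p - 1) / 8`. Modulo the conjugate of `π` we have `π ≡ 2 a`, so
`π ^ (2 m) ≡ 4 ^ m * a ^ (2 m)`, and everything rests on the congruence
`a ^ (2 m) ≡ (-1) ^ m (mod p)`. Since `16 ∣ b ^ 2`, the sign `(-1) ^ m` is `χ₈ |a|`, where `χ₈` is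
the quadratic character modulo `8` cut out by `√2`. As `-1` is a fourth power modulo `p` and both
sides are multiplicative, it is enough to show `q ^ (2 m) ≡ χ₈ q (mod p)` for each prime `q ∣ a`
(`ZMod.prime_pow_eq_χ₈`).

This is a rational case of quartic reciprocity, and is proved with Gauss sums in characteristic `q`.
Let `χ` be a character of order four modulo `p` and `J = J(χ, χ) ∈ ℤ[i]`. Its norm is `p` and its
imaginary part is even, so `J = ± a ± b i`. In characteristic `q` the terms `± a` vanish, so
`J ^ 2 = -b ^ 2` and `p = b ^ 2`, and the Gauss sum `g` of `χ` satisfies `g ^ 4 = p J ^ 2 = -b ^ 4`.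
Comparing this with the action of Frobenius on `g` gives `χ q = χ₈ q`
(`MulChar.apply_natCast_eq_χ₈`), and a character of order four that is `± 1` at `q` has the same
value there as `x ↦ x ^ (2 m)` (`MulChar.pow_eq_of_orderOf_eq_four`).
-/

/-! ### Characters of order four -/

theorem MulChar.exists_sq_eq_neg_one_of_orderOf_eq_four {F R : Type*} [Field F] [CommRing R]
    [IsDomain R] {χ : MulChar F R} (hχ : orderOf χ = 4) : ∃ x : Fˣ, χ x ^ 2 = -1 := by
  have h4 : χ ^ 4 = 1 := hχ ▸ pow_orderOf_eq_one χ
  have h2 : χ ^ 2 ≠ 1 := fun h => by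
    have := orderOf_dvd_of_pow_eq_one h
    rw [hχ] at this
    omega
  obtain ⟨x, hx⟩ := (MulChar.ne_one_iff).1 h2
  refine ⟨x, ?_⟩
  rw [MulChar.pow_apply_coe] at hx
  have h : χ x ^ 4 = 1 := by rw [← MulChar.pow_apply_coe, h4, MulChar.one_apply_coe]
  have h' : (χ x ^ 2) ^ 2 = 1 := by rw [← pow_mul]; exact h
  exact (sq_eq_one_iff.1 h').resolve_left hx

theorem MulChar.orderOf_ringHomComp_eq_four {F R S : Type*} [Field F] [CommRing R]
    [IsDomain R] [CommRing S] [IsDomain S] {χ : MulChar F R} (hχ : orderOf χ = 4)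
    (f : R →+* S) (h2 : (2 : S) ≠ 0) : orderOf (χ.ringHomComp f) = 4 := by
  have h4 : χ ^ 4 = 1 := hχ ▸ pow_orderOf_eq_one χ
  obtain ⟨x, hx⟩ := χ.exists_sq_eq_neg_one_of_orderOf_eq_four hχ
  refine orderOf_eq_prime_pow (p := 2) (n := 1) (fun h => h2 ?_) ?_
  · have : (χ.ringHomComp f ^ (2 ^ 1)) x = 1 := by rw [h, MulChar.one_apply_coe]
    rw [MulChar.pow_apply_coe, MulChar.ringHomComp_apply, ← map_pow, pow_one, hx, map_neg,
      map_one] at this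
    linear_combination -this
  · rw [MulChar.ringHomComp_pow]
    norm_num [h4]

/-- A character of order four taking a value `±1` at `x` detects `x ^ ((p - 1) / 4)`. -/
theorem MulChar.pow_eq_of_orderOf_eq_four {p : ℕ} [Fact p.Prime] {R : Type*} [CommRing R]
    [IsDomain R] (h2 : (2 : R) ≠ 0) {χ : MulChar (ZMod p) R} (hχ : orderOf χ = 4)
    {n : ℕ} (hn : p - 1 = 4 * n) (x : (ZMod p)ˣ) {s : ℤ} (hs : s = 1 ∨ s = -1)
    (hx : χ x = s) : (x : ZMod p) ^ n = s := by
  obtain ⟨g, hg⟩ := IsCyclic.exists_generator (α := (ZMod p)ˣ)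
  have h4 : χ ^ 4 = 1 := hχ ▸ pow_orderOf_eq_one χ
  have hord : orderOf g = p - 1 := by
    rw [orderOf_eq_card_of_forall_mem_zpowers hg, Nat.card_eq_fintype_card, ZMod.card_units]
  have hp1 : 1 < p := (Fact.out : p.Prime).one_lt
  -- the value at a generator is a primitive fourth root of unity
  have hc : χ g ^ 2 = -1 := by
    have hc4 : (χ g ^ 2) ^ 2 = 1 := by
      rw [← pow_mul, ← MulChar.pow_apply_coe, h4, MulChar.one_apply_coe]
    refine (sq_eq_one_iff.1 hc4).resolve_left fun h => ?_
    have : χ ^ 2 = 1 := by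
      rw [MulChar.eq_iff hg, MulChar.pow_apply_coe, h, MulChar.one_apply_coe]
    have := orderOf_dvd_of_pow_eq_one this
    rw [hχ] at this
    omega
  have hg4 : g ^ (4 * n) = 1 := by rw [← hn, ← hord, pow_orderOf_eq_one]
  have hg2 : (g : ZMod p) ^ (2 * n) = -1 := by
    have h1 : ((g : ZMod p) ^ (2 * n)) ^ 2 = 1 := by
      rw [← pow_mul, show 2 * n * 2 = 4 * n by ring]
      simpa using congrArg Units.val hg4
    refine (sq_eq_one_iff.1 h1).resolve_left fun h => ?_
    have h' : g ^ (2 * n) = 1 := Units.ext (by simpa using h)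
    have := Nat.le_of_dvd (by omega) (orderOf_dvd_of_pow_eq_one h')
    omega
  have hg4' : (g : ZMod p) ^ (4 * n) = 1 := by simpa using congrArg Units.val hg4
  obtain ⟨k, rfl⟩ : ∃ k : ℕ, g ^ k = x := 
    Submonoid.mem_powers_iff _ _ |>.1 (mem_powers_iff_mem_zpowers.2 (hg x))
  have hk := Nat.div_add_mod k 4
  have hr : k % 4 < 4 := Nat.mod_lt _ (by norm_num)
  set m := k / 4
  have hval : χ g ^ k = χ g ^ (k % 4) := by
    rw [← hk, pow_add, pow_mul, show χ g ^ 4 = (χ g ^ 2) ^ 2 by ring, hc]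
    simp [Nat.add_mod]
  have hpow : (g : ZMod p) ^ (k * n) = g ^ (k % 4 * n) := by
    conv_lhs => rw [← hk]
    rw [add_mul, pow_add, show 4 * m * n = 4 * n * m by ring, pow_mul, hg4', one_pow, one_mul]
  rw [Units.val_pow_eq_pow_val, map_pow, hval] at hx
  rw [Units.val_pow_eq_pow_val, ← pow_mul, hpow]
  have hs2 : (s : R) ^ 2 = 1 := by rcases hs with rfl | rfl <;> simp
  interval_cases k % 4
  · rcases hs with rfl | rfl
    · simp
    · exact absurd (by push_cast at hx; linear_combination hx) h2
  · rw [pow_one] at hx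
    exact absurd (by linear_combination hc - (χ g + s) * hx - hs2) h2
  · rcases hs with rfl | rfl
    · exact absurd (by push_cast at hx; linear_combination hc - hx) h2
    · simpa using hg2
  · exact h2.elim (by
      linear_combination (χ g ^ 4 - χ g ^ 2 + 1) * hc - (χ g ^ 3 + s) * hx - hs2)

theorem MulChar.apply_neg_one_of_orderOf_eq_four {p : ℕ} [Fact p.Prime] {R : Type*} [CommRing R]
    [IsDomain R] (h2 : (2 : R) ≠ 0) {χ : MulChar (ZMod p) R} (hχ : orderOf χ = 4)
    (hp8 : p % 8 = 1) : χ (-1) = 1 := by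
  have h : χ (-1) ^ 2 = 1 := by rw [← map_pow]; simp
  by_contra h1
  have h' := (sq_eq_one_iff.1 h).resolve_left h1
  have hone := χ.pow_eq_of_orderOf_eq_four h2 hχ (n := (p - 1) / 4) (by omega) (-1)
    (s := -1) (Or.inr rfl) (by simpa using h')
  rw [Units.val_neg, Units.val_one, Even.neg_one_pow ⟨(p - 1) / 8, by omega⟩] at hone
  have : Fact (2 < p) := ⟨by have := (Fact.out : p.Prime).two_le; omega⟩
  exact ZMod.neg_one_ne_one (n := p) (by simpa using hone.symm)

/-! ### The Jacobi sum of a quartic character in `ℤ[i]` -/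

theorem GaussianInt.isPrimitiveRoot_four : IsPrimitiveRoot (⟨0, 1⟩ : GaussianInt) 4 := by
  refine IsPrimitiveRoot.mk_of_lt _ (by norm_num) (by decide) fun l h0 h4 => ?_
  interval_cases l <;> decide

theorem norm_jacobiSum_self_of_orderOf_eq_four {p : ℕ} [Fact p.Prime]
    {χ : MulChar (ZMod p) GaussianInt} (hχ : orderOf χ = 4) :
    Zsqrtd.norm (jacobiSum χ χ) = p := by
  have hχ' := χ.orderOf_ringHomComp_eq_four hχ GaussianInt.toComplex two_ne_zero
  set φ := χ.ringHomComp GaussianInt.toComplex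
  have h1 : φ ≠ 1 := fun h => by rw [h, orderOf_one] at hχ'; omega
  have h2 : φ * φ ≠ 1 := fun h => by
    have := orderOf_dvd_of_pow_eq_one ((sq φ).trans h)
    rw [hχ'] at this
    omega
  have hJ := jacobiSum_mul_jacobiSum_inv (χ := φ) (φ := φ) (by
    rw [ringChar.eq ℂ 0, ZMod.ringChar_zmod_n]
    exact (Fact.out : p.Prime).ne_zero.symm) h1 h1 h2
  have hstar : jacobiSum φ⁻¹ φ⁻¹ = star (jacobiSum φ φ) := by
    have hs : star φ = φ.ringHomComp (starRingEnd ℂ) := rfl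
    rw [← MulChar.star_eq_inv, hs, jacobiSum_ringHomComp, starRingEnd_apply]
  rw [hstar, jacobiSum_ringHomComp, ZMod.card, ← starRingEnd_apply,
    ← GaussianInt.toComplex_star, ← map_mul, ← Zsqrtd.norm_eq_mul_conj, map_intCast] at hJ
  exact_mod_cast hJ

/-- In fact `J(χ, χ) ≡ -1` modulo `(i - 1) ^ 2 = -2 i`. -/
theorem even_im_jacobiSum_self_of_orderOf_eq_four {p : ℕ} [Fact p.Prime]
    {χ : MulChar (ZMod p) GaussianInt} (hχ : orderOf χ = 4) :
    Even (jacobiSum χ χ).im := by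
  have h4 : χ ^ 4 = 1 := hχ ▸ pow_orderOf_eq_one χ
  obtain ⟨z, -, hz⟩ := exists_jacobiSum_eq_neg_one_add (n := 4) (by norm_num) h4 h4
    (hχ ▸ χ.orderOf_dvd_card_sub_one) GaussianInt.isPrimitiveRoot_four
  rw [hz, sq]
  refine ⟨-z.re, ?_⟩
  simp
  ring

/-- Uniqueness of the representation of a prime as a sum of an odd and an even square. -/
theorem GaussianInt.sq_re_eq_and_sq_im_eq {a b u v : ℤ} (hπ : Prime (⟨a, b⟩ : GaussianInt))
    (h : u ^ 2 + v ^ 2 = a ^ 2 + b ^ 2) (ha : Odd a) (hb : Even b) (hv : Even v) :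
    u ^ 2 = a ^ 2 ∧ v ^ 2 = b ^ 2 := by
  have hpos : a ^ 2 + b ^ 2 ≠ 0 := by
    have : a ≠ 0 := by rintro rfl; simp at ha
    positivity
  have hmul : (⟨a, b⟩ : GaussianInt) * ⟨a, -b⟩ = ⟨u, v⟩ * ⟨u, -v⟩ := by
    ext <;> simp <;> linarith
  -- a multiple of `a + b i` of the same norm differs from it by a unit
  have key : ∀ v' : ℤ, v' ^ 2 = v ^ 2 → Even v' → (⟨a, b⟩ : GaussianInt) ∣ ⟨u, v'⟩ →
      u ^ 2 = a ^ 2 := by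
    rintro v' hv' hev ⟨⟨c, d⟩, hw⟩
    rw [Zsqrtd.ext_iff] at hw
    simp at hw
    obtain ⟨h1, h2⟩ := hw
    have hcd : c ^ 2 + d ^ 2 = 1 := by
      apply mul_left_cancel₀ hpos
      rw [← hv', h1, h2] at h
      linear_combination h
    have hc : c ^ 2 ≤ 1 := by nlinarith [sq_nonneg d]
    have hd : d ^ 2 ≤ 1 := by nlinarith [sq_nonneg c]
    have hc1 := abs_le.1 ((sq_le_one_iff_abs_le_one c).1 hc)
    have hd1 := abs_le.1 ((sq_le_one_iff_abs_le_one d).1 hd)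
    obtain ⟨c1, c2⟩ := hc1
    obtain ⟨d1, d2⟩ := hd1
    interval_cases c <;> interval_cases d <;> simp at hcd <;> simp at h1 h2 <;> subst h1 <;>
      first | ring1 | (exfalso; subst h2; grind)
  have hu : u ^ 2 = a ^ 2 := by
    rcases hπ.dvd_or_dvd (Dvd.intro _ hmul) with h | h
    · exact key v rfl hv h
    · exact key (-v) (by ring) hv.neg h
  exact ⟨hu, by linarith⟩

/-! ### Prime divisors of the odd coordinate -/

theorem gaussSum_pow_four_of_orderOf_eq_four {p : ℕ} [Fact p.Prime] {F : Type*} [Field F]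
    (h2 : (2 : F) ≠ 0) {χ : MulChar (ZMod p) F} (hχ : orderOf χ = 4) (hp8 : p % 8 = 1)
    {ψ : AddChar (ZMod p) F} (hψ : ψ.IsPrimitive) :
    gaussSum χ ψ ^ 4 = p * jacobiSum χ χ ^ 2 := by
  have hne : χ ^ 2 ≠ 1 := fun h => by
    have := orderOf_dvd_of_pow_eq_one h
    rw [hχ] at this
    omega
  have hinv : (χ ^ 2)⁻¹ = χ ^ 2 := by
    rw [inv_eq_iff_mul_eq_one, ← pow_add]
    exact orderOf_dvd_iff_pow_eq_one.1 hχ.dvd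
  have h1 := jacobiSum_mul_nontrivial (χ := χ) (φ := χ) (by rwa [← sq]) ψ
  have h3 := gaussSum_mul_gaussSum_eq_card hne hψ
  have h5 : gaussSum (χ ^ 2) ψ⁻¹ = gaussSum (χ ^ 2) ψ := by
    have := mul_gaussSum_inv_eq_gaussSum (χ ^ 2) ψ
    rwa [MulChar.pow_apply' _ two_ne_zero, χ.apply_neg_one_of_orderOf_eq_four h2 hχ hp8,
      one_pow, one_mul] at this
  rw [hinv, h5, ZMod.card] at h3
  rw [← sq] at h1
  linear_combination jacobiSum χ χ ^ 2 * h3 -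
    (gaussSum (χ ^ 2) ψ * jacobiSum χ χ + gaussSum χ ψ * gaussSum χ ψ) * h1

theorem gaussSum_mul_gaussSum_inv_of_orderOf_eq_four {p : ℕ} [Fact p.Prime] {F : Type*} [Field F]
    (h2 : (2 : F) ≠ 0) {χ : MulChar (ZMod p) F} (hχ : orderOf χ = 4) (hp8 : p % 8 = 1)
    {ψ : AddChar (ZMod p) F} (hψ : ψ.IsPrimitive) :
    gaussSum χ ψ * gaussSum χ⁻¹ ψ = p := by
  have hne : χ ≠ 1 := fun h => by rw [h, orderOf_one] at hχ; omega
  have h := gaussSum_mul_gaussSum_pow_orderOf_sub_one hne hψ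
  rw [χ.apply_neg_one_of_orderOf_eq_four h2 hχ hp8, ZMod.card, one_mul, hχ] at h
  have : χ⁻¹ = χ ^ 3 := by
    rw [inv_eq_iff_mul_eq_one, ← pow_succ']
    exact orderOf_dvd_iff_pow_eq_one.1 hχ.dvd
  rwa [this]

/-- The value at `q` of a quartic character `χ` with values in characteristic `q`, when
`p = b ^ 2` and `J(χ, χ) ^ 2 = -b ^ 2` there. The Gauss sum `g` then satisfies `g ^ 4 = -b ^ 4`, so
`g ^ (q ∓ 1)` is known, while Frobenius maps `g` to a multiple of the Gauss sum of `χ` or `χ⁻¹` by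
a value of `χ` at `q`, according as `q` is `1` or `3` modulo `4`. -/
theorem MulChar.apply_natCast_eq_χ₈ {p q : ℕ} [Fact p.Prime] [Fact q.Prime] (hq : q ≠ 2)
    {F : Type*} [Field F] [CharP F q] {χ : MulChar (ZMod p) F} (hχ : orderOf χ = 4)
    (hp8 : p % 8 = 1) {ψ : AddChar (ZMod p) F} (hψ : ψ.IsPrimitive) (x : (ZMod p)ˣ)
    (hx : (x : ZMod p) = q) {b : ℤ} (hb : (b : F) ≠ 0) (hpb : (p : F) = b ^ 2)
    (hJ : jacobiSum χ χ ^ 2 = -b ^ 2) : χ x = (ZMod.χ₈ q : ℤ) := by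
  have hqp : q.Prime := Fact.out
  have h2 : (2 : F) ≠ 0 := Ring.two_ne_zero (by rwa [ringChar.eq F q])
  have hq2 : q % 2 = 1 := hqp.eq_two_or_odd.resolve_left hq
  have h4 : χ ^ 4 = 1 := hχ ▸ pow_orderOf_eq_one χ
  set g := gaussSum χ ψ
  have hg4 : g ^ 4 = -b ^ 4 := by
    rw [gaussSum_pow_four_of_orderOf_eq_four h2 hχ hp8 hψ, hJ, hpb]; ring
  have hg0 : g ≠ 0 := by
    rintro h
    rw [h] at hg4
    exact hb (by simpa using hg4)
  have hbq : (b : F) ^ q = b := by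
    rw [← frobenius_def, map_intCast]
  have hbq1 : (b : F) ^ (q - 1) = 1 := by
    apply mul_left_cancel₀ hb
    rw [← pow_succ', Nat.sub_add_cancel hqp.one_le, hbq, mul_one]
  have hfrob : (χ ^ q) x * g ^ q = gaussSum (χ ^ q) ψ := by
    rw [gaussSum_frob, AddChar.pow_mulShift, ← hx, gaussSum_mulShift]
  rw [ZMod.χ₈_nat_eq_if_mod_eight]
  rcases (by omega : q % 4 = 1 ∨ q % 4 = 3) with h | h
  · have hχq : χ ^ q = χ := by
      rw [← Nat.div_add_mod q 4, h, pow_add, pow_mul, h4, one_pow, one_mul, pow_one]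
    rw [hχq] at hfrob
    have hgq : χ x * g ^ (q - 1) = 1 := by
      apply mul_right_cancel₀ hg0
      rw [mul_assoc, ← pow_succ, Nat.sub_add_cancel hqp.one_le, hfrob, one_mul]
    have hgp : g ^ (q - 1) = (-1) ^ ((q - 1) / 4) := by
      have e : q - 1 = 4 * ((q - 1) / 4) := by omega
      conv_lhs => rw [e]
      rw [pow_mul, hg4, neg_pow, ← pow_mul, ← e, hbq1, mul_one]
    rw [hgp] at hgq
    rcases (by omega : q % 8 = 1 ∨ q % 8 = 5) with h' | h'
    · rw [Even.neg_one_pow (Nat.even_iff.2 (by omega)), mul_one] at hgq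
      simp [h', hq2, hgq]
    · rw [Odd.neg_one_pow (Nat.odd_iff.2 (by omega))] at hgq
      simp [h', hq2]
      linear_combination -hgq
  · have hχq : χ ^ q = χ⁻¹ := by
      rw [← Nat.div_add_mod q 4, h, pow_add, pow_mul, h4, one_pow, one_mul,
        eq_inv_iff_mul_eq_one, ← pow_succ, h4]
    rw [hχq] at hfrob
    have hgq : χ⁻¹ x * g ^ (q + 1) = b ^ 2 := by
      rw [← hpb, ← gaussSum_mul_gaussSum_inv_of_orderOf_eq_four h2 hχ hp8 hψ, ← hfrob]
      ring
    have hgp : g ^ (q + 1) = (-1) ^ ((q + 1) / 4) * b ^ 2 := by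
      have e : q + 1 = 4 * ((q + 1) / 4) := by omega
      conv_lhs => rw [e]
      rw [pow_mul, hg4, neg_pow, ← pow_mul, ← e, pow_succ, hbq, sq]
    have hxx : χ⁻¹ x * χ x = 1 := by
      rw [← MulChar.mul_apply, inv_mul_cancel, MulChar.one_apply_coe]
    rw [hgp, ← mul_assoc] at hgq
    have hgq' : χ⁻¹ x * (-1) ^ ((q + 1) / 4) = 1 :=
      mul_right_cancel₀ (pow_ne_zero 2 hb) (by rw [hgq, one_mul])
    rcases (by omega : q % 8 = 7 ∨ q % 8 = 3) with h' | h'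
    · rw [Even.neg_one_pow (Nat.even_iff.2 (by omega)), mul_one] at hgq'
      rw [hgq', one_mul] at hxx
      simp [h', hq2, hxx]
    · rw [Odd.neg_one_pow (Nat.odd_iff.2 (by omega))] at hgq'
      simp [h', hq2]
      linear_combination -hxx - χ x * hgq'

/-- A prime divisor `q` of the odd coordinate of `p = a ^ 2 + b ^ 2` has
`q ^ ((p - 1) / 4) ≡ χ₈ q` modulo `p`. -/
theorem ZMod.prime_pow_eq_χ₈ {a b : ℤ} {p q : ℕ} [Fact p.Prime] [Fact q.Prime]
    (hπ : Prime (⟨a, b⟩ : GaussianInt)) (hp : a ^ 2 + b ^ 2 = p) (hp8 : p % 8 = 1)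
    (ha : Odd a) (hb : Even b) (hq : (q : ℤ) ∣ a) :
    (q : ZMod p) ^ ((p - 1) / 4) = (ZMod.χ₈ q : ℤ) := by
  have hqp : q.Prime := Fact.out
  have hpp : p.Prime := Fact.out
  have hq2 : q ≠ 2 := by
    rintro rfl
    exact (Int.not_even_iff_odd.2 ha) (even_iff_two_dvd.2 hq)
  obtain ⟨χ, hχ⟩ := MulChar.exists_mulChar_orderOf (ZMod p) (n := 4)
    (by rw [ZMod.card]; omega) GaussianInt.isPrimitiveRoot_four
  let F := AlgebraicClosure (ZMod q)
  have : CharP F q := charP_of_injective_algebraMap (algebraMap (ZMod q) F).injective q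
  have h2 : (2 : F) ≠ 0 := Ring.two_ne_zero (by rwa [ringChar.eq F q])
  have haF : (a : F) = 0 := (CharP.intCast_eq_zero_iff F q a).2 hq
  have hpF : (p : F) = b ^ 2 := by
    have : ((a ^ 2 + b ^ 2 : ℤ) : F) = p := by rw [hp]; simp
    rw [← this]; push_cast; rw [haF]; ring
  have hpq : q ≠ p := by
    rintro rfl
    have h1 : (q : ℤ) ∣ b ^ 2 := by
      rw [eq_sub_of_add_eq' hp]; exact dvd_sub dvd_rfl (dvd_pow hq two_ne_zero)
    have h3 : (q : ℤ) ∣ b := (Nat.prime_iff_prime_int.1 hqp).dvd_of_dvd_pow h1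
    have h4 : (q : ℤ) ^ 2 ∣ q := by
      conv_rhs => rw [← hp]
      exact dvd_add (pow_dvd_pow_of_dvd hq 2) (pow_dvd_pow_of_dvd h3 2)
    have h5 : q ^ 2 ∣ q := by exact_mod_cast h4
    have := Nat.le_of_dvd hqp.pos h5
    nlinarith [hqp.two_le]
  have hpF0 : (p : F) ≠ 0 := fun h => hpq
    ((Nat.prime_dvd_prime_iff_eq hqp hpp).1 ((CharP.cast_eq_zero_iff F q p).1 h))
  have hbF : (b : F) ≠ 0 := fun h => hpF0 (by rw [hpF, h]; simp)
  have : NeZero (p : F) := ⟨hpF0⟩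
  obtain ⟨ζ, hζ⟩ := HasEnoughRootsOfUnity.exists_primitiveRoot F p
  obtain ⟨r, hr⟩ := IsAlgClosed.exists_pow_nat_eq (-1 : F) (n := 2) (by norm_num)
  let f : GaussianInt →+* F := Zsqrtd.lift ⟨r, by rw [← sq, hr]; simp⟩
  have hχ' := χ.orderOf_ringHomComp_eq_four hχ f h2
  have hqu : IsUnit (q : ZMod p) := by
    rw [ZMod.isUnit_iff_coprime]
    exact (Nat.coprime_primes hqp hpp).2 hpq
  obtain ⟨x, hx⟩ := hqu
  set J := jacobiSum χ χ with hJdef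
  have hnorm : J.re ^ 2 + J.im ^ 2 = a ^ 2 + b ^ 2 := by
    rw [hp, ← norm_jacobiSum_self_of_orderOf_eq_four hχ, Zsqrtd.norm_def]; ring
  obtain ⟨hre, him⟩ := GaussianInt.sq_re_eq_and_sq_im_eq hπ hnorm ha hb
    (even_im_jacobiSum_self_of_orderOf_eq_four hχ)
  -- `q` divides the real part of `J`, so `J` is purely imaginary modulo `q`
  have hreF : (J.re : F) = 0 := by
    have : ((J.re ^ 2 : ℤ) : F) = ((a ^ 2 : ℤ) : F) := by rw [hre]
    push_cast at this
    rw [haF] at this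
    simpa using this
  have himF : (J.im : F) ^ 2 = b ^ 2 := by exact_mod_cast congrArg (Int.cast : ℤ → F) him
  have hJ : jacobiSum (χ.ringHomComp f) (χ.ringHomComp f) ^ 2 = -(b : F) ^ 2 := by
    rw [jacobiSum_ringHomComp, ← hJdef]
    have : f J = J.re + J.im * r := rfl
    rw [this, hreF, ← himF, zero_add, mul_pow, hr]
    ring
  have key := MulChar.apply_natCast_eq_χ₈ hq2 hχ' hp8
    (AddChar.zmodChar_primitive_of_primitive_root p hζ) x hx hbF hpF hJ
  rw [← hx]
  refine MulChar.pow_eq_of_orderOf_eq_four h2 hχ' (by omega) x ?_ key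
  have hodd : q % 2 = 1 := hqp.eq_two_or_odd.resolve_left hq2
  rw [ZMod.χ₈_nat_eq_if_mod_eight]
  split_ifs <;> omega

theorem ZMod.natAbs_pow_eq_χ₈ {a b : ℤ} {p : ℕ} [Fact p.Prime]
    (hπ : Prime (⟨a, b⟩ : GaussianInt)) (hp : a ^ 2 + b ^ 2 = p) (hp8 : p % 8 = 1)
    (ha : Odd a) (hb : Even b) :
    (a.natAbs : ZMod p) ^ ((p - 1) / 4) = (ZMod.χ₈ a.natAbs : ℤ) := by
  have key : ∀ n : ℕ, (n : ℤ) ∣ a → (n : ZMod p) ^ ((p - 1) / 4) = (ZMod.χ₈ n : ℤ) := by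
    intro n
    induction n using induction_on_primes with
    | zero =>
      intro h
      simp only [Nat.cast_zero, zero_dvd_iff] at h
      subst h
      simp at ha
    | one => simp
    | prime_mul q n hq ih =>
      intro h
      have : Fact q.Prime := ⟨hq⟩
      push_cast at h
      rw [Nat.cast_mul, Nat.cast_mul, mul_pow, map_mul, Int.cast_mul,
        ih (dvd_of_mul_left_dvd h),
        ZMod.prime_pow_eq_χ₈ hπ hp hp8 ha hb (dvd_of_mul_right_dvd h)]
  exact key _ (Int.natAbs_dvd.2 dvd_rfl)

/-- As `16 ∣ b ^ 2`, the parity of `(p - 1) / 8` is that of `(a ^ 2 - 1) / 8`. -/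
theorem ZMod.χ₈_natAbs_eq_neg_one_pow {a b : ℤ} {p : ℕ} (hp : a ^ 2 + b ^ 2 = p) (ha : Odd a)
    (hb : 4 ∣ b) : ZMod.χ₈ a.natAbs = (-1) ^ ((p - 1) / 8) := by
  obtain ⟨c, rfl⟩ := hb
  obtain ⟨d, hd⟩ : ∃ d : ℕ, (c ^ 2 : ℤ) = d := ⟨(c ^ 2).natAbs, by simp⟩
  have hn : a.natAbs ^ 2 + 16 * d = p := by
    zify
    rw [sq_abs, ← hp, ← hd]; ring
  have hodd : a.natAbs % 2 = 1 := Nat.odd_iff.1 (Int.natAbs_odd.2 ha)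
  rw [ZMod.χ₈_nat_eq_if_mod_eight]
  set n := a.natAbs
  obtain ⟨k, r, hr, hkr⟩ : ∃ k r, r < 8 ∧ n = 8 * k + r :=
    ⟨n / 8, n % 8, Nat.mod_lt _ (by norm_num), (Nat.div_add_mod n 8).symm⟩
  have hm : n % 8 = r := by omega
  have hsq : p = 16 * (4 * k ^ 2 + k * r + d) + r ^ 2 := by rw [← hn, hkr]; ring
  generalize 4 * k ^ 2 + k * r + d = t at hsq
  rw [hm]
  interval_cases r <;> first | omega | skip
  · rw [Even.neg_one_pow (Nat.even_iff.2 (by omega))]; simp [hodd]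
  · rw [Odd.neg_one_pow (Nat.odd_iff.2 (by omega))]; simp [hodd]
  · rw [Odd.neg_one_pow (Nat.odd_iff.2 (by omega))]; simp [hodd]
  · rw [Even.neg_one_pow (Nat.even_iff.2 (by omega))]; simp [hodd]

/-! ### The power `π ^ ((p - 1) / 4)` modulo the conjugate of `π` -/

/-- The symbol `(-4 / p)₈` is defined: the square of this power is `2 ^ ((p - 1) / 2)`, and `2` is
a square modulo `p`. -/
theorem ZMod.neg_four_pow_eq_one_or_neg_one {p : ℕ} [Fact p.Prime] (hp8 : p % 8 = 1) :
    (-4 : ZMod p) ^ ((p - 1) / 8) = 1 ∨ (-4 : ZMod p) ^ ((p - 1) / 8) = -1 := by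
  have hp2 : p ≠ 2 := by rintro rfl; omega
  have h2 : (2 : ZMod p) ≠ 0 := Ring.two_ne_zero (by rwa [ZMod.ringChar_zmod_n])
  have hsq : IsSquare (2 : ZMod p) := (ZMod.exists_sq_eq_two_iff hp2).2 (Or.inl hp8)
  have h := (ZMod.euler_criterion p h2).1 hsq
  rw [← sq_eq_one_iff, ← pow_mul, ← h, mul_comm, pow_mul]
  norm_num
  rw [show (16 : ZMod p) = 2 ^ 4 by norm_num, ← pow_mul]
  congr 1
  omega

/-- Modulo its conjugate, `a + b i` is `2 a`, and the `(p - 1) / 4`-th power of `2 a` is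
`(-4) ^ ((p - 1) / 8)` modulo `p`. -/
theorem GaussianInt.star_dvd_pow_sub {a b : ℤ} {p : ℕ} [Fact p.Prime]
    (hπ : Prime (⟨a, b⟩ : GaussianInt)) (hp : a ^ 2 + b ^ 2 = p) (hp8 : p % 8 = 1)
    (ha : Odd a) (hb : 4 ∣ b) {s : ℤ} (hs : (-4 : ZMod p) ^ ((p - 1) / 8) = s) :
    star (⟨a, b⟩ : GaussianInt) ∣ ⟨a, b⟩ ^ ((p - 1) / 4) - (s : GaussianInt) := by
  have hbe : Even b := even_iff_two_dvd.2 (dvd_trans (by norm_num) hb)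
  have he : (p - 1) / 4 = 2 * ((p - 1) / 8) := by omega
  have hapow : (a : ZMod p) ^ ((p - 1) / 4) = (-1) ^ ((p - 1) / 8) := by
    have h1 := ZMod.natAbs_pow_eq_χ₈ hπ hp hp8 ha hbe
    rw [ZMod.χ₈_natAbs_eq_neg_one_pow hp ha hb, he, pow_mul, ← Int.cast_natCast, ← Int.cast_pow,
      Int.natAbs_sq] at h1
    rw [he, pow_mul, ← Int.cast_pow, h1]
    simp
  have h2a : ((2 * a : ℤ) : ZMod p) ^ ((p - 1) / 4) = s := by
    rw [← hs]
    push_cast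
    rw [mul_pow, hapow, he, pow_mul, ← mul_pow]
    norm_num
  have hdvd : (p : ℤ) ∣ (2 * a) ^ ((p - 1) / 4) - s := by
    rw [← ZMod.intCast_zmod_eq_zero_iff_dvd]
    rw [Int.cast_sub, Int.cast_pow, h2a, sub_self]
  have hstar : star (⟨a, b⟩ : GaussianInt) ∣ ((p : ℤ) : GaussianInt) := by
    refine ⟨⟨a, b⟩, ?_⟩
    rw [mul_comm, ← Zsqrtd.norm_eq_mul_conj, Zsqrtd.norm_def, ← hp]
    ring_nf
  have h1 : star (⟨a, b⟩ : GaussianInt) ∣ ((2 * a : ℤ) : GaussianInt) ^ ((p - 1) / 4) - s := by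
    refine hstar.trans ?_
    have := map_dvd (Int.castRingHom GaussianInt) hdvd
    simpa using this
  have h3 : star (⟨a, b⟩ : GaussianInt) ∣
      ⟨a, b⟩ ^ ((p - 1) / 4) - ((2 * a : ℤ) : GaussianInt) ^ ((p - 1) / 4) := by
    refine Dvd.dvd.trans ⟨-1, ?_⟩ (sub_dvd_pow_sub_pow _ _ _)
    ext <;> simp
    ring
  simpa using dvd_add h3 h1

theorem lemma7 (a b : ℤ) (p : ℕ)
    (hp : p.Prime)
    (hπ : Prime (⟨a, b⟩ : GaussianInt))
    (hnorm : Zsqrtd.norm (⟨a, b⟩ : GaussianInt) = (p : ℤ))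
    (hp8 : p ≡ 1 [MOD 8])
    (hb : 4 ∣ b)
    (ha : a ≡ 1 [ZMOD 4]) :
    quarticSymbol ⟨a, b⟩ (star (⟨a, b⟩ : GaussianInt)) = (octicSymbol (-4) p : GaussianInt) := by
  have : Fact p.Prime := ⟨hp⟩
  have hp8' : p % 8 = 1 := hp8
  have hp2 : 2 < p := by have := hp.two_le; omega
  have : Fact (2 < p) := ⟨hp2⟩
  have hodd : Odd a := by
    rw [Int.odd_iff]
    have : a % 4 = 1 := ha
    omega
  have hsum : a ^ 2 + b ^ 2 = p := by rw [← hnorm, Zsqrtd.norm_def]; ring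
  have hnstar : Zsqrtd.norm (star (⟨a, b⟩ : GaussianInt)) = p := by
    rw [Zsqrtd.norm_conj, hnorm]
  -- this separates the units: `-1` differs from `i` and `1` by elements of norm `2` and `4`
  have hnd : ∀ z : GaussianInt, Zsqrtd.norm z ∣ 4 → ¬ star (⟨a, b⟩ : GaussianInt) ∣ z := by
    rintro z hz ⟨w, rfl⟩
    rw [Zsqrtd.norm_mul, hnstar] at hz
    have h4 : p ∣ 2 ^ 2 := by exact_mod_cast dvd_of_mul_right_dvd hz
    have := Nat.le_of_dvd (by norm_num) (hp.dvd_of_dvd_pow h4)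
    omega
  unfold quarticSymbol octicSymbol
  rw [hnstar, Int.natAbs_natCast]
  simp only [← ZMod.intCast_eq_intCast_iff]
  push_cast
  rcases ZMod.neg_four_pow_eq_one_or_neg_one (p := p) hp8' with h | h
  · have hd := GaussianInt.star_dvd_pow_sub hπ hsum hp8' hodd hb (s := 1) (by simpa using h)
    rw [Int.cast_one] at hd
    rw [if_pos hd, if_pos h]
  · have hd := GaussianInt.star_dvd_pow_sub hπ hsum hp8' hodd hb (s := -1) (by simpa using h)
    rw [Int.cast_neg, Int.cast_one, sub_neg_eq_add] at hd
    rw [if_neg fun h' => hnd _ (by rw [add_sub_sub_cancel]; decide) (dvd_sub hd h'),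
      if_neg fun h' => hnd _ (by rw [add_sub_sub_cancel]; decide) (dvd_sub hd h'), if_pos hd,
      if_neg (by rw [h]; exact ZMod.neg_one_ne_one), if_pos h]
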